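/- Let $T,D$ be the unitary operators $[Tf](x)=f(x-1)$, $[Df](x)=2^{1/2}f(2x)$ on $L^2(\mathbb R)$, and let $\langle f,g\rangle$ be linear in $f$. Let $\mathbb I,\mathbb J$ be countable index sets, $\{L_i^{(0)}\}_{i\in\mathbb I}$ an orthonormal basis of $L^2[0,1)$ and, for each sign $s=\pm$, $\{K_{s,j}^{(0)}\}_{j\in\mathbb J}$ an orthonormal basis of $L^2$ of $[1,2)$ (for $s=+$), respectively of $(-2,-1]$ (for $s=-$), all functions being extended by $0$. Put $L_i^{(n)}=T^nL_i^{(0)}$, $K_{s,j}^{(m)}=D^mK_{s,j}^{(0)}$ and $$\hat f_i^{(n)}=\langle f,L_i^{(n)}\rangle,\qquad \tilde f_{s,j}^{(m)}=\langle f,K_{s,j}^{(m)}\rangle,\qquad \alpha_{i,n}^{s,j,m}=\langle L_i^{(n)},K_{s,j}^{(m)}\rangle .$$ Let $\partial\mathbb D$ be the unit circle with normalized Lebesgue measure, let $\{u_{s,j}\}$ be an orthonormal basis of $l^2(\mathbb J)\oplus l^2(\mathbb J)$, and let $\mathcal G:L^2(\mathbb R)\to L^2(\partial\mathbb D;l^2(\mathbb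 J)\oplus l^2(\mathbb J))$ be the unitary operator $$\mathcal Gf=\bigoplus_{s=\pm}\bigoplus_{j\in\mathbb J}\Big[\sum_{m\in\mathbb Z}\omega^m\tilde f_{s,j}^{(m)}\Big]u_{s,j}.$$ Let $\Psi$ be a finite or countable family in $L^2(\mathbb R)$ such that $X=\{\psi_{k,j}=D^kT^j\psi:\psi\in\Psi,\ k,j\in\mathbb Z\}$, indexed by the triples $(k,j,\psi)$, is a Bessel system: for some $B>0$, $\sum_{k,j,\psi}|\langle f,\psi_{k,j}\rangle|^2\le B\|f\|^2$ for all $f\in L^2(\mathbb R)$. Let $T_X c=\sum_{k,j,\psi}c_{k,j,\psi}\,\psi_{k,j}$ be its (bounded) synthesis operator on $\ell^2$ and $S=T_XT_X^*$. Then, for all $s,s'=\pm$, $l,l'\in\mathbb J$ and $\sigma\in\mathbb Z$, the coefficient $$c_{s,l}^{s',l'}(\sigma)=\sum_{\substack{i,n\\ i',n'}}\Big({\sum_{k,j\in\mathbb Z}}^{u}\ \overline{\alpha_{i,n+j}^{s,l,k}}\;\alpha_{i',n'+j}^{s',l',k+\sigma}\Big)\Big({\sum_{\psi\in\Psi}}^{u}\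 \overline{\hat\psi_i^{(n)}}\;\hat\psi_{i'}^{(n')}\Big)$$ exists in the following unconditional sense: for every finite set $F\subset\mathbb Z\times\mathbb Z\times\Psi$ the series $\sum_{i,n,i',n'}\sum_{(k,j,\psi)\in F}\overline{\alpha_{i,n+j}^{s,l,k}}\,\alpha_{i',n'+j}^{s',l',k+\sigma}\,\overline{\hat\psi_i^{(n)}}\,\hat\psi_{i'}^{(n')}$ converges absolutely, and its value tends to $c_{s,l}^{s',l'}(\sigma)$ along the directed set of all finite $F$; in particular (for $F=A\times B$) $$c_{s,l}^{s',l'}(\sigma)=\lim_{A,B}\sum_{\substack{i,n\\ i',n'}}\Big(\sum_{(k,j)\in A}\overline{\alpha_{i,n+j}^{s,l,k}}\,\alpha_{i',n'+j}^{s',l',k+\sigma}\Big)\Big(\sum_{\psi\in B}\overline{\hat\psi_i^{(n)}}\,\hat\psi_{i'}^{(n')}\Big)$$ over the finite sets $A\subset\mathbb Z^2$, $B\subset\Psi$. The Fourier series $\sum_\sigma\omega^\sigma c_{s,l}^{s',l'}(\sigma)$ converges in $L^2(\partial\mathbb D)$, and the matrix element of $\mathcal GS\mathcal G^{-1}$ from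 $u_{s,l}$ to $u_{s',l'}$, that is, the map sending $h$ to the component of $\mathcal GS\mathcal G^{-1}(h\,u_{s,l})$ along $u_{s',l'}$, is the multiplication operator $$[\mathcal GS\mathcal G^{-1}]_{s,l}^{s',l'}:L^2(\partial\mathbb D)\to L^2(\partial\mathbb D),\qquad h(\omega)\mapsto h(\omega)\sum_{\sigma}\omega^\sigma\,c_{s,l}^{s',l'}(\sigma).$$ Consequently $\mathcal GS\mathcal G^{-1}$ is decomposable, $[\mathcal GS\mathcal G^{-1}\mathbf v](\omega)=S(\omega)\mathbf v(\omega)$ a.e., and its fibers $S(\omega)$, bounded operators on $l^2(\mathbb J)\oplus l^2(\mathbb J)$, are given for a.e. $\omega\in\partial\mathbb D$ by $$S(\omega)\,u_{s,l}=\bigoplus_{s',l'}u_{s',l'}\sum_\sigma\omega^\sigma\,c_{s,l}^{s',l'}(\sigma)\qquad(s=\pm,\ l\in\mathbb J).$$ -/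

import Mathlib

open MeasureTheory Filter Topology
open scoped ENNReal

noncomputable section

namespace WaveletSpectral

/-! ### Translation and dilation on `L²(ℝ)`

Mathlib's inner product is conjugate-linear in the first argument: the scalar product `⟨f, g⟩` that
is linear in `f` is `inner ℂ g f`. -/

/-- The complex Hilbert space `L²(ℝ)`. -/
abbrev L2R : Type := Lp ℂ 2 (volume : Measure ℝ)

/-- Translation `[T f](x) = f (x - 1)`, a unitary operator on `L²(ℝ)`. -/
def translation : L2R ≃ₗᵢ[ℂ] L2R :=
  LinearIsometryEquiv.ofSurjective
    (Lp.compMeasurePreservingₗᵢ ℂ (fun x : ℝ => x - 1) (measurePreserving_sub_right volume 1))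
    (fun g => by
      refine ⟨Lp.compMeasurePreserving (fun x : ℝ => x + 1)
        (measurePreserving_add_right volume 1) g, ?_⟩
      change Lp.compMeasurePreserving (fun x : ℝ => x - 1) _
        (Lp.compMeasurePreserving (fun x : ℝ => x + 1) _ g) = g
      apply Lp.ext
      filter_upwards [Lp.coeFn_compMeasurePreserving
          (Lp.compMeasurePreserving (fun x : ℝ => x + 1) (measurePreserving_add_right volume 1) g)
          (measurePreserving_sub_right volume (1 : ℝ)),
        (measurePreserving_sub_right volume (1 : ℝ)).quasiMeasurePreserving.ae
          (Lp.coeFn_compMeasurePreserving g (measurePreserving_add_right volume (1 : ℝ)))]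
        with x h1 h2
      rw [h1, Function.comp_apply, h2, Function.comp_apply, sub_add_cancel])

theorem translation_ae (f : L2R) : ∀ᵐ x : ℝ, translation f x = f (x - 1) :=
  Lp.coeFn_compMeasurePreserving f (measurePreserving_sub_right volume 1)

theorem quasi_mul {a : ℝ} (ha : 0 < a) :
    Measure.QuasiMeasurePreserving (fun x : ℝ => a * x) volume volume := by
  refine ⟨measurable_const_mul a, ?_⟩
  rw [Real.map_volume_mul_left ha.ne']
  exact Measure.smul_absolutelyContinuous

theorem eLpNorm_dilate {a : ℝ} (ha : 0 < a) (f : L2R) :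
    eLpNorm (fun x : ℝ => (Real.sqrt a : ℂ) * f (a * x)) 2 volume = eLpNorm f 2 volume := by
  have h1 : eLpNorm (fun x : ℝ => f (a * x)) 2 volume
      = eLpNorm f 2 (Measure.map (fun x : ℝ => a * x) volume) :=
    ((Homeomorph.mulLeft₀ a ha.ne').measurableEmbedding.eLpNorm_map_measure
      (g := f) (p := 2) (μ := volume)).symm
  have h2 : (fun x : ℝ => (Real.sqrt a : ℂ) * f (a * x))
      = (Real.sqrt a : ℂ) • (fun x : ℝ => f (a * x)) := by
    funext x; simp
  rw [h2, eLpNorm_const_smul, h1, Real.map_volume_mul_left ha.ne',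
    eLpNorm_smul_measure_of_ne_top (by norm_num), smul_eq_mul, ← mul_assoc]
  have h3 : ‖(Real.sqrt a : ℂ)‖ₑ * ENNReal.ofReal |a⁻¹| ^ (1 / (2 : ℝ≥0∞)).toReal = 1 := by
    rw [abs_of_pos (inv_pos.2 ha), ← ofReal_norm, Complex.norm_real,
      Real.norm_of_nonneg (Real.sqrt_nonneg a),
      ENNReal.ofReal_rpow_of_pos (inv_pos.2 ha), ← ENNReal.ofReal_mul (Real.sqrt_nonneg a)]
    have : (1 / (2 : ℝ≥0∞)).toReal = (1 / 2 : ℝ) := by simp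
    rw [this, ← Real.sqrt_eq_rpow, Real.sqrt_inv, mul_inv_cancel₀ (Real.sqrt_pos.2 ha).ne']
    simp
  rw [h3, one_mul]

theorem memLp_dilate {a : ℝ} (ha : 0 < a) (f : L2R) :
    MemLp (fun x : ℝ => (Real.sqrt a : ℂ) * f (a * x)) 2 volume := by
  refine ⟨?_, ?_⟩
  · exact ((Lp.aestronglyMeasurable f).comp_quasiMeasurePreserving (quasi_mul ha)).const_mul _
  · rw [eLpNorm_dilate ha]; exact Lp.eLpNorm_lt_top f

/-- `f ↦ √a f (a ·)` on `L²(ℝ)`, for `a > 0`. -/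
def dilate {a : ℝ} (ha : 0 < a) : L2R →ₗᵢ[ℂ] L2R where
  toFun f := (memLp_dilate ha f).toLp _
  map_add' f g := by
    apply Lp.ext
    filter_upwards [(memLp_dilate ha (f + g)).coeFn_toLp, (memLp_dilate ha f).coeFn_toLp,
      (memLp_dilate ha g).coeFn_toLp, (quasi_mul ha).ae (Lp.coeFn_add f g),
      Lp.coeFn_add ((memLp_dilate ha f).toLp _) ((memLp_dilate ha g).toLp _)]
      with x h1 h2 h3 h4 h5
    rw [h1, h5, Pi.add_apply, h2, h3, h4, Pi.add_apply, mul_add]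
  map_smul' c f := by
    apply Lp.ext
    filter_upwards [(memLp_dilate ha (c • f)).coeFn_toLp, (memLp_dilate ha f).coeFn_toLp,
      (quasi_mul ha).ae (Lp.coeFn_smul c f),
      Lp.coeFn_smul c ((memLp_dilate ha f).toLp _)] with x h1 h2 h3 h4
    rw [h1, RingHom.id_apply, h4, Pi.smul_apply, h2, h3, Pi.smul_apply, smul_eq_mul, smul_eq_mul]
    ring
  norm_map' f := by
    change ‖(memLp_dilate ha f).toLp _‖ = ‖f‖
    rw [Lp.norm_toLp, eLpNorm_dilate ha, ← Lp.norm_def]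

theorem dilate_ae {a : ℝ} (ha : 0 < a) (f : L2R) :
    ∀ᵐ x : ℝ, dilate ha f x = (Real.sqrt a : ℂ) * f (a * x) :=
  (memLp_dilate ha f).coeFn_toLp

/-- Dyadic dilation `[D f](x) = 2^{1/2} f (2 x)`, a unitary operator on `L²(ℝ)`. -/
def dilation : L2R ≃ₗᵢ[ℂ] L2R :=
  LinearIsometryEquiv.ofSurjective (dilate (a := 2) (by norm_num)) (fun g => by
    refine ⟨dilate (a := 2⁻¹) (by norm_num) g, ?_⟩
    apply Lp.ext
    filter_upwards [dilate_ae (a := 2) (by norm_num) (dilate (a := 2⁻¹) (by norm_num) g),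
      (quasi_mul (a := 2) (by norm_num)).ae (dilate_ae (a := 2⁻¹) (by norm_num) g)] with x h1 h2
    rw [h1, h2, ← mul_assoc, ← Complex.ofReal_mul, ← Real.sqrt_mul (by norm_num)]
    simp)

theorem dilation_ae (f : L2R) :
    ∀ᵐ x : ℝ, dilation f x = (Real.sqrt 2 : ℂ) * f (2 * x) :=
  dilate_ae (a := 2) (by norm_num) f

/-! ### Wavelet systems, Bessel systems, synthesis operators -/

/-- The wavelet system `ψ_{k,j} = D^k T^j ψ` generated by the family `(ψ g)_{g ∈ γ}`, indexed by the
triples `(k, j, g)`. -/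
def waveletSystem {γ : Type*} (ψ : γ → L2R) (t : ℤ × ℤ × γ) : L2R :=
  (dilation ^ t.1) ((translation ^ t.2.1) (ψ t.2.2))

/-- `(x_a)` is a Bessel system: `∑ |⟨f, x_a⟩|² ≤ B ‖f‖²` for some constant `B > 0`. -/
def IsBessel {A H : Type*} [NormedAddCommGroup H] [InnerProductSpace ℂ H] (x : A → H) : Prop :=
  ∃ B : ℝ, 0 < B ∧ ∀ f : H,
    Summable (fun a => ‖inner ℂ (x a) f‖ ^ 2) ∧ ∑' a, ‖inner ℂ (x a) f‖ ^ 2 ≤ B * ‖f‖ ^ 2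

/-- The bounded operator `TX : ℓ² → H` is the synthesis operator of `(x_a)`:
`TX c = ∑ c_a x_a`, with unconditional convergence. -/
def IsSynthesis {A H : Type*} [NormedAddCommGroup H] [InnerProductSpace ℂ H] (x : A → H)
    (TX : lp (fun _ : A => ℂ) 2 →L[ℂ] H) : Prop :=
  ∀ c : lp (fun _ : A => ℂ) 2, HasSum (fun a => c a • x a) (TX c)

/-! ### The orthonormal bases and the change of basis coefficients -/

/-- `(b_i)` is an orthonormal basis of `L²(E)`, the space of functions in `L²(ℝ)` that vanish
almost everywhere outside `E`. -/
def IsONBOn {A : Type*} (E : Set ℝ) (b : A → L2R) : Prop :=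
  Orthonormal ℂ b ∧
    ((Submodule.span ℂ (Set.range b)).topologicalClosure : Set L2R)
      = {f : L2R | ∀ᵐ x : ℝ, x ∉ E → f x = 0}

/-- `[1, 2)` for the sign `+` and `(-2, -1]` for the sign `-` (the latter is `[-2, -1)` up to a null
set). -/
def dyadicShell (s : ℤˣ) : Set ℝ := {x : ℝ | ((s : ℤ) : ℝ) * x ∈ Set.Ico (1 : ℝ) 2}

/-- `L_i^{(n)} = T^n L_i^{(0)}`. -/
def transBasis {I : Type*} (L : I → L2R) (i : I) (n : ℤ) : L2R := (translation ^ n) (L i)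

/-- `K_{s,j}^{(m)} = D^m K_{s,j}^{(0)}`. -/
def dilBasis {J : Type*} (K : ℤˣ → J → L2R) (s : ℤˣ) (j : J) (m : ℤ) : L2R :=
  (dilation ^ m) (K s j)

/-- `f̂_i^{(n)} = ⟨f, L_i^{(n)}⟩`. -/
def hatCoeff {I : Type*} (L : I → L2R) (f : L2R) (i : I) (n : ℤ) : ℂ :=
  inner ℂ (transBasis L i n) f

/-- `f̃_{s,j}^{(m)} = ⟨f, K_{s,j}^{(m)}⟩`. -/
def tildeCoeff {J : Type*} (K : ℤˣ → J → L2R) (f : L2R) (s : ℤˣ) (j : J) (m : ℤ) : ℂ :=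
  inner ℂ (dilBasis K s j m) f

/-- The change of basis matrix `α_{i,n}^{s,j,m} = ⟨L_i^{(n)}, K_{s,j}^{(m)}⟩`. -/
def changeCoeff {I J : Type*} (L : I → L2R) (K : ℤˣ → J → L2R)
    (i : I) (n : ℤ) (s : ℤˣ) (j : J) (m : ℤ) : ℂ :=
  inner ℂ (dilBasis K s j m) (transBasis L i n)

/-! ### `L²` spaces over the unit circle and the dilation representation -/

instance circleMeasurableSpace : MeasurableSpace Circle := borel Circle

instance circleBorelSpace : BorelSpace Circle := ⟨rfl⟩

/-- The normalized Lebesgue measure `dω / 2π` on the unit circle: the image of the normalized Haar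
measure of `ℝ / 2πℤ` under `θ ↦ e^{iθ}`. -/
def circleMeasure : Measure Circle :=
  haveI : Fact (0 < 2 * Real.pi) := ⟨Real.two_pi_pos⟩
  Measure.map (fun θ : AddCircle (2 * Real.pi) => AddCircle.toCircle θ) AddCircle.haarAddCircle

instance circleMeasure_isProbabilityMeasure : IsProbabilityMeasure circleMeasure := by
  have : Fact (0 < 2 * Real.pi) := ⟨Real.two_pi_pos⟩
  exact Measure.isProbabilityMeasure_map AddCircle.continuous_toCircle.measurable.aemeasurable

/-- `L²(∂𝔻; H)`. -/
abbrev L2Circle (H : Type*) [NormedAddCommGroup H] : Type _ := Lp H 2 circleMeasure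

/-- `l²(𝕁) ⊕ l²(𝕁)` with the Hilbert sum norm. -/
abbrev L2Sum (J : Type*) : Type _ := WithLp 2 (lp (fun _ : J => ℂ) 2 × lp (fun _ : J => ℂ) 2)

theorem memLp_monomial (m : ℤ) :
    MemLp (fun ω : Circle => (((ω ^ m : Circle)) : ℂ)) 2 circleMeasure := by
  refine MemLp.of_bound (C := 1) ?_ (Filter.Eventually.of_forall fun ω => (Circle.norm_coe _).le)
  have hc : Continuous (fun ω : Circle => ((ω ^ m : Circle) : ℂ)) :=
    Continuous.comp (g := fun z : Circle => (z : ℂ)) (by fun_prop) (continuous_zpow m)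
  exact hc.aestronglyMeasurable

/-- The function `ω ↦ ω^m` in `L²(∂𝔻)`. -/
def monomial (m : ℤ) : L2Circle ℂ := (memLp_monomial m).toLp _

/-- `h ↦ h(ω) u`, from `L²(∂𝔻)` to `L²(∂𝔻; H)`. -/
def alongVec {H : Type*} [NormedAddCommGroup H] [InnerProductSpace ℂ H] (u : H) :
    L2Circle ℂ →L[ℂ] L2Circle H :=
  (ContinuousLinearMap.toSpanSingleton ℂ u).compLpL 2 circleMeasure

/-- `v ↦ ⟨v(ω), u⟩`, from `L²(∂𝔻; H)` to `L²(∂𝔻)`: the component along a unit vector `u`. -/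
def componentAt {H : Type*} [NormedAddCommGroup H] [InnerProductSpace ℂ H] (u : H) :
    L2Circle H →L[ℂ] L2Circle ℂ :=
  (innerSL ℂ u).compLpL 2 circleMeasure

/-- The matrix element `L²(∂𝔻) → L²(∂𝔻)` of an operator `A` on `L²(∂𝔻; H)` from the direction `u`
to the direction `u'`. -/
def matrixElement {H : Type*} [NormedAddCommGroup H] [InnerProductSpace ℂ H]
    (A : L2Circle H →L[ℂ] L2Circle H) (u u' : H) : L2Circle ℂ →L[ℂ] L2Circle ℂ :=
  (componentAt u').comp (A.comp (alongVec u))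

/-- The unitary `G : L²(ℝ) → L²(∂𝔻; l²(𝕁) ⊕ l²(𝕁))` is the dilation representation:
`G f = ⨁_{s,j} [∑_m ω^m f̃_{s,j}^{(m)}] u_{s,j}`, all the sums converging in the `L²` sense. -/
def IsDilationRepresentation {J : Type*} (K : ℤˣ → J → L2R)
    (u : HilbertBasis (ℤˣ × J) ℂ (L2Sum J)) (G : L2R ≃ₗᵢ[ℂ] L2Circle (L2Sum J)) : Prop :=
  ∀ f : L2R, ∃ ftilde : ℤˣ × J → L2Circle ℂ,
    (∀ p, HasSum (fun m : ℤ => tildeCoeff K f p.1 p.2 m • monomial m) (ftilde p)) ∧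
    HasSum (fun p => alongVec (u p) (ftilde p)) (G f)

/-- `ω ↦ S(ω)` is a field of fibers of the bounded operator `A` on `L²(∂𝔻; H)` (so that `A` is
decomposable): `[A v](ω) = S(ω) v(ω)` for a.e. `ω`, for each `v`. -/
def IsFiberField {H : Type*} [NormedAddCommGroup H] [InnerProductSpace ℂ H]
    (A : L2Circle H →L[ℂ] L2Circle H) (S : Circle → H →L[ℂ] H) : Prop :=
  ∀ v : L2Circle H, ∀ᵐ ω ∂circleMeasure, A v ω = S ω (v ω)

/-! ### The coefficients -/

/-- The factor `conj α_{i,n+j}^{s,l,k} · α_{i',n'+j}^{s',l',k+σ}`, with `p = (s,l)`, `p' = (s',l')`,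
`a = (i,n)`, `a' = (i',n')`. -/
def alphaFactor {I J : Type*} (L : I → L2R) (K : ℤˣ → J → L2R) (p p' : ℤˣ × J) (σ : ℤ)
    (a a' : I × ℤ) (k j : ℤ) : ℂ :=
  starRingEnd ℂ (changeCoeff L K a.1 (a.2 + j) p.1 p.2 k)
    * changeCoeff L K a'.1 (a'.2 + j) p'.1 p'.2 (k + σ)

/-- The factor `conj ψ̂_i^{(n)} · ψ̂_{i'}^{(n')}`, with `a = (i,n)`, `a' = (i',n')`. -/
def psiFactor {I : Type*} (L : I → L2R) (ψ : L2R) (a a' : I × ℤ) : ℂ :=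
  starRingEnd ℂ (hatCoeff L ψ a.1 a.2) * hatCoeff L ψ a'.1 a'.2

/-- `c = ∑_{i,n,i',n'} (∑ᵘ_{k,j} conj α_{i,n+j}^{s,l,k} α_{i',n'+j}^{s',l',k+σ})
(∑ᵘ_ψ conj ψ̂_i^{(n)} ψ̂_{i'}^{(n')})`, where the superscript `u` means that the value is the
limit over the finite sets of triples `(k, j, ψ)`: for a finite set of triples the sum over `(i, n, i', n')` converges absolutely, and these values converge to `c` along the directed
set of all finite sets of triples; for product sets `A ×ˢ B` the summand is the product of the two
finite sums. -/
def IsUnconditionalCoeff {I J γ : Type*} (L : I → L2R) (K : ℤˣ → J → L2R) (ψ : γ → L2R)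
    (p p' : ℤˣ × J) (σ : ℤ) (c : ℂ) : Prop :=
  (∀ F : Finset (ℤ × ℤ × γ), Summable fun q : (I × ℤ) × (I × ℤ) =>
    ∑ t ∈ F, alphaFactor L K p p' σ q.1 q.2 t.1 t.2.1 * psiFactor L (ψ t.2.2) q.1 q.2) ∧
  Tendsto (fun F : Finset (ℤ × ℤ × γ) => ∑' q : (I × ℤ) × (I × ℤ),
    ∑ t ∈ F, alphaFactor L K p p' σ q.1 q.2 t.1 t.2.1 * psiFactor L (ψ t.2.2) q.1 q.2)
    atTop (𝓝 c) ∧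
  Tendsto (fun AB : Finset (ℤ × ℤ) × Finset γ => ∑' q : (I × ℤ) × (I × ℤ),
    (∑ kj ∈ AB.1, alphaFactor L K p p' σ q.1 q.2 kj.1 kj.2)
      * (∑ g ∈ AB.2, psiFactor L (ψ g) q.1 q.2))
    atTop (𝓝 c)

end WaveletSpectral

end

/-! The unitary `G` sends the basis vector `D^m K_p` to `ω^m u_p`, so it turns `D` into
multiplication by `ω`. The operator `S` commutes with `D`: its entry from `K_p^{(m)}` to
`K_{p'}^{(m')}` is a sum over `(k, j, ψ)` in which `D^k` can be moved onto the `K`'s, and the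
substitution `k ↦ m - k` leaves only the difference `m' - m` (`hasSum_crossCoeff`). Hence `A = G S
G⁻¹` satisfies `A (h u_p) = h · A u_p` (`coeFn_eq_zpow_smul`, `apply_alongVec_ae`), and the
multipliers are the components of the columns `A u_p`.

For the formula of the coefficients, `T^j ψ` is expanded in the basis `L_i^{(n)}`, where `T^j`
shifts `n` to `n + j`. Each term `(k, j, ψ)` is then a product of two absolutely convergent series,
finite sums of terms may be interchanged with these, and the limit over finite sets `F` is that of
an `ℓ²` inner product (`isUnconditionalCoeff_of_hasSum`).

The fibers are first defined on finite combinations of the `u_p` by the columns. Testing `A` on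
indicator functions bounds them a.e. by `‖A‖`, so they extend by density (`exists_isFiberField`). -/

noncomputable section

namespace WaveletSpectral

/-! ### The synthesis operator of a Bessel system -/

section Synthesis

variable {A H : Type*} [NormedAddCommGroup H] [InnerProductSpace ℂ H]

/-- The analysis operator `f ↦ (⟨f, x_a⟩)_a` of a Bessel system. -/
theorem IsBessel.exists_analysis {x : A → H} (hx : IsBessel x) :
    ∃ R : H →L[ℂ] lp (fun _ : A => ℂ) 2, ∀ f a, R f a = inner ℂ (x a) f := by
  obtain ⟨B, hB, h⟩ := hx
  have hp : (0 : ℝ) < (2 : ℝ≥0∞).toReal := by norm_num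
  have hmem : ∀ f, Memℓp (fun a => inner ℂ (x a) f : A → ℂ) 2 := fun f => by
    rw [memℓp_gen_iff hp]
    simpa using (h f).1
  let R : H →ₗ[ℂ] lp (fun _ : A => ℂ) 2 :=
    { toFun := fun f => ⟨_, hmem f⟩
      map_add' := fun f g => by ext a; exact inner_add_right _ _ _
      map_smul' := fun c f => by ext a; exact inner_smul_right _ _ _ }
  refine ⟨R.mkContinuous (Real.sqrt B) fun f => ?_, fun f a => rfl⟩
  refine le_of_sq_le_sq ?_ (by positivity)
  have h2 := lp.norm_rpow_eq_tsum hp (R f)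
  simp only [ENNReal.toReal_ofNat, Real.rpow_ofNat] at h2
  rw [h2, mul_pow, Real.sq_sqrt hB.le]
  exact (h f).2

/-- A Bessel system has a bounded synthesis operator, the adjoint of the analysis operator. -/
theorem IsBessel.exists_isSynthesis [CompleteSpace H] {x : A → H} (hx : IsBessel x) :
    ∃ TX : lp (fun _ : A => ℂ) 2 →L[ℂ] H, IsSynthesis x TX ∧
      ∀ f a, ContinuousLinearMap.adjoint TX f a = inner ℂ (x a) f := by
  classical
  obtain ⟨R, hR⟩ := hx.exists_analysis
  refine ⟨ContinuousLinearMap.adjoint R, fun c => ?_, fun f a => by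
    rw [ContinuousLinearMap.adjoint_adjoint, hR]⟩
  -- Expand `c` in coordinate vectors; the adjoint of analysis sends the one at `a` to a multiple of
  -- `x a`, as testing against every `f` shows.
  convert (lp.hasSum_single (by norm_num) c).mapL (ContinuousLinearMap.adjoint R) using 2 with a
  refine ext_inner_right ℂ fun f => ?_
  rw [ContinuousLinearMap.adjoint_inner_left, lp.inner_single_left, hR, inner_smul_left]
  simp [mul_comm]

end Synthesis

/-! ### Orthonormal bases of `L²(ℝ)` from orthonormal bases on the pieces of a partition -/

theorem inner_eq_zero_of_disjoint {E F : Set ℝ} (hd : Disjoint E F) {f g : L2R}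
    (hf : ∀ᵐ x : ℝ, x ∉ E → f x = 0) (hg : ∀ᵐ x : ℝ, x ∉ F → g x = 0) : inner ℂ f g = 0 := by
  rw [L2.inner_def]
  refine integral_eq_zero_of_ae ?_
  filter_upwards [hf, hg] with x h1 h2
  by_cases hx : x ∈ E
  · simp [h2 (Set.disjoint_left.1 hd hx)]
  · simp [h1 hx]

theorem IsONBOn.vanish {A : Type*} {E : Set ℝ} {b : A → L2R} (h : IsONBOn E b) (a : A) :
    ∀ᵐ x : ℝ, x ∉ E → b a x = 0 := by
  have h1 : b a ∈ ((Submodule.span ℂ (Set.range b)).topologicalClosure : Set L2R) :=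
    Submodule.le_topologicalClosure _ (Submodule.subset_span ⟨a, rfl⟩)
  rw [h.2] at h1
  exact h1

/-- The truncation `g = 1_E f` lies in the closed span, to which `f` is orthogonal, so `⟨g, g⟩ = ⟨g,
f⟩ = 0`. -/
theorem IsONBOn.eq_zero_of_inner_eq_zero {A : Type*} {E : Set ℝ} (hE : MeasurableSet E)
    {b : A → L2R} (h : IsONBOn E b) {f : L2R} (hf : ∀ a, inner ℂ (b a) f = 0) :
    ∀ᵐ x : ℝ, x ∈ E → f x = 0 := by
  have hm : MemLp (E.indicator f) 2 volume := (Lp.memLp f).indicator hE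
  set g : L2R := hm.toLp _ with hgdef
  have hg : ∀ᵐ x : ℝ, g x = E.indicator f x := hm.coeFn_toLp
  have hgE : g ∈ (Submodule.span ℂ (Set.range b)).topologicalClosure := by
    rw [← SetLike.mem_coe, h.2]
    filter_upwards [hg] with x hx hxE
    rw [hx, Set.indicator_of_notMem hxE]
  have hforth : f ∈ (Submodule.span ℂ (Set.range b)).topologicalClosureᗮ := by
    rw [Submodule.orthogonal_closure, Submodule.mem_orthogonal]
    intro v hv
    induction hv using Submodule.span_induction with
    | mem v hv => obtain ⟨a, rfl⟩ := hv; exact hf a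
    | zero => exact inner_zero_left _
    | add v w _ _ hv hw => rw [inner_add_left, hv, hw, add_zero]
    | smul c v _ hv => rw [inner_smul_left, hv, mul_zero]
  have h0 : inner ℂ g f = 0 := (Submodule.mem_orthogonal _ _).1 hforth g hgE
  have h1 : inner ℂ g g = 0 := by
    rw [← h0, L2.inner_def, L2.inner_def]
    refine integral_congr_ae ?_
    filter_upwards [hg] with x hx
    by_cases hxE : x ∈ E <;> simp [hx, hxE]
  have h2 : g = 0 := inner_self_eq_zero.1 h1
  filter_upwards [hg, (Lp.eq_zero_iff_ae_eq_zero).1 h2] with x hx hx0 hxE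
  rw [← Set.indicator_of_mem hxE f, ← hx, hx0, Pi.zero_apply]

/-- Disjoint supports give orthogonality across pieces; a function orthogonal to everything vanishes
a.e. on each of countably many pieces. The equivalence `σ` frees the indexing of the basis from that
of the pieces. -/
theorem exists_hilbertBasis_of_partition {ι A B : Type*} [Countable A] (σ : ι ≃ A × B)
    (E : A → Set ℝ) (hE : ∀ a, MeasurableSet (E a)) (hd : Pairwise fun a a' => Disjoint (E a) (E a'))
    (hc : ∀ᵐ x : ℝ, ∃ a, x ∈ E a) (e : A → B → L2R) (he : ∀ a, IsONBOn (E a) (e a)) :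
    ∃ b : HilbertBasis ι ℂ L2R, ∀ i, b i = e (σ i).1 (σ i).2 := by
  have ho : Orthonormal ℂ fun i => e (σ i).1 (σ i).2 := by
    refine ⟨fun i => (he _).1.1 _, fun i i' hii' => ?_⟩
    by_cases ha : (σ i).1 = (σ i').1
    · have hb : (σ i).2 ≠ (σ i').2 := fun hb => hii' (σ.injective (Prod.ext ha hb))
      simp only [ha]
      exact (he _).1.2 hb
    · exact inner_eq_zero_of_disjoint (hd ha) ((he _).vanish _) ((he _).vanish _)
  refine ⟨HilbertBasis.mkOfOrthogonalEqBot ho ?_, fun i => by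
    rw [HilbertBasis.coe_mkOfOrthogonalEqBot]⟩
  rw [Submodule.eq_bot_iff]
  intro f hf
  have h0 : ∀ a, ∀ᵐ x : ℝ, x ∈ E a → f x = 0 := fun a =>
    (he a).eq_zero_of_inner_eq_zero (hE a) fun b =>
      (Submodule.mem_orthogonal _ _).1 hf _
        (Submodule.subset_span ⟨σ.symm (a, b), by simp⟩)
  rw [Lp.eq_zero_iff_ae_eq_zero]
  filter_upwards [hc, ae_all_iff.2 h0] with x ⟨a, ha⟩ hx
  exact hx a ha

theorem IsONBOn.map {A : Type*} {E E' : Set ℝ} {b : A → L2R} (h : IsONBOn E b)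
    (U : L2R ≃ₗᵢ[ℂ] L2R)
    (hU : ∀ f : L2R, (∀ᵐ x : ℝ, x ∉ E → f x = 0) ↔ ∀ᵐ x : ℝ, x ∉ E' → U f x = 0) :
    IsONBOn E' fun a => U (b a) := by
  refine ⟨h.1.comp_linearIsometryEquiv U, ?_⟩
  have h1 : Submodule.span ℂ (Set.range fun a => U (b a))
      = (Submodule.span ℂ (Set.range b)).map (U.toLinearEquiv : L2R →ₗ[ℂ] L2R) := by
    rw [Submodule.map_span, ← Set.range_comp]; rfl
  have h2 : ((Submodule.span ℂ (Set.range fun a => U (b a))).topologicalClosure : Set L2R)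
      = U '' (Submodule.span ℂ (Set.range b)).topologicalClosure := by
    rw [Submodule.topologicalClosure_coe, Submodule.topologicalClosure_coe, h1]
    exact (U.toHomeomorph.image_closure _).symm
  rw [h2, h.2]
  ext g
  constructor
  · rintro ⟨f, hf, rfl⟩
    exact (hU f).1 hf
  · intro hg
    refine ⟨U.symm g, (hU _).2 ?_, U.apply_symm_apply g⟩
    rw [U.apply_symm_apply]
    exact hg

/-! ### Powers of a unitary operator `f ↦ c f(φ(·))` -/

section Powers

variable {U : L2R ≃ₗᵢ[ℂ] L2R} {c : ℂ} {φ : ℤ → ℝ → ℝ}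

theorem zpow_apply_ae (hc : c ≠ 0)
    (hq : ∀ n, Measure.QuasiMeasurePreserving (φ n) volume volume) (h0 : ∀ x, φ 0 x = x)
    (hadd : ∀ m n x, φ (m + n) x = φ m (φ n x))
    (hU : ∀ f : L2R, ∀ᵐ x : ℝ, U f x = c * f (φ 1 x)) (n : ℤ) :
    ∀ f : L2R, ∀ᵐ x : ℝ, (U ^ n) f x = c ^ n * f (φ n x) := by
  induction n using Int.induction_on with
  | zero => intro f; simp [h0]
  | succ n ih =>
    intro f
    filter_upwards [ih (U f), (hq n).ae (hU f)] with x h1 h2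
    rw [zpow_add_one, LinearIsometryEquiv.coe_mul, Function.comp_apply, h1, h2, ← hadd, zpow_add_one₀ hc,
      add_comm (1 : ℤ), mul_assoc]
  | pred n ih =>
    intro f
    -- Here `hU` is read backwards: at `U⁻¹ f` and the point `φ (-n - 1) x` it recovers `f` from
    -- `U⁻¹ f`.
    filter_upwards [ih (U⁻¹ f), (hq (-n - 1)).ae (hU (U⁻¹ f))] with x h1 h2
    have h3 : U (U⁻¹ f) = f := U.apply_symm_apply f
    rw [h3, ← hadd, show (1 : ℤ) + (-n - 1) = -n by ring] at h2
    rw [zpow_sub_one, LinearIsometryEquiv.coe_mul, Function.comp_apply, h1, h2, zpow_sub_one₀ hc]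
    field_simp

theorem IsONBOn.zpow (hc : c ≠ 0)
    (hq : ∀ n, Measure.QuasiMeasurePreserving (φ n) volume volume) (h0 : ∀ x, φ 0 x = x)
    (hadd : ∀ m n x, φ (m + n) x = φ m (φ n x))
    (hU : ∀ f : L2R, ∀ᵐ x : ℝ, U f x = c * f (φ 1 x)) {A : Type*} {E : Set ℝ} {b : A → L2R}
    (h : IsONBOn E b) (n : ℤ) : IsONBOn (φ n ⁻¹' E) fun a => (U ^ n) (b a) := by
  refine h.map (U ^ n) fun f => ⟨fun hf => ?_, fun hf => ?_⟩
  · filter_upwards [zpow_apply_ae hc hq h0 hadd hU n f, (hq n).ae hf] with x h1 h2 hx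
    rw [h1, h2 hx, mul_zero]
  -- Pulling back along `φ (-n)` undoes the substitution, and `c ^ n ≠ 0` then gives the vanishing
  -- of `f`.
  · filter_upwards [(hq (-n)).ae (zpow_apply_ae hc hq h0 hadd hU n f), (hq (-n)).ae hf]
      with x h1 h2 hx
    have h3 : φ n (φ (-n) x) = x := by rw [← hadd, add_neg_cancel, h0]
    rw [Set.mem_preimage, h3] at h2
    rw [h3, h2 hx] at h1
    exact (mul_eq_zero.1 h1.symm).resolve_left (zpow_ne_zero n hc)

end Powers

/-- The intervals `[n, n + 1)` tile the line, and `⌊x⌋` names the tile of `x`. -/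
theorem exists_hilbertBasis_transBasis {I : Type*} {L : I → L2R}
    (hL : IsONBOn (Set.Ico (0 : ℝ) 1) L) :
    ∃ b : HilbertBasis (I × ℤ) ℂ L2R, ∀ a, b a = transBasis L a.1 a.2 := by
  refine exists_hilbertBasis_of_partition (Equiv.prodComm I ℤ)
    (fun n => (fun x : ℝ => x - n) ⁻¹' Set.Ico (0 : ℝ) 1)
    (fun n => measurableSet_Ico.preimage (measurable_id.sub_const _)) ?_ ?_
    (fun n i => (translation ^ n) (L i)) fun n => ?_
  · intro n n' hn
    refine Set.disjoint_left.2 fun x h1 h2 => hn ?_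
    simp only [Set.mem_preimage, Set.mem_Ico] at h1 h2
    have e1 : ⌊x⌋ = n := Int.floor_eq_iff.2 ⟨by linarith, by linarith⟩
    have e2 : ⌊x⌋ = n' := Int.floor_eq_iff.2 ⟨by linarith, by linarith⟩
    exact e1.symm.trans e2
  · refine Eventually.of_forall fun x => ⟨⌊x⌋, ?_⟩
    exact ⟨Int.fract_nonneg x, Int.fract_lt_one x⟩
  · refine hL.zpow (U := translation) (c := 1) (φ := fun n x => x - n) one_ne_zero
      (fun n => (measurePreserving_sub_right volume (n : ℝ)).quasiMeasurePreserving)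
      (fun x => by simp) (fun m n x => by push_cast; ring) (fun f => ?_) n
    filter_upwards [translation_ae f] with x hx
    simp [hx]

theorem exists_hilbertBasis_dilBasis {J : Type*} {K : ℤˣ → J → L2R}
    (hK : ∀ s : ℤˣ, IsONBOn (dyadicShell s) (K s)) :
    ∃ b : HilbertBasis ((ℤˣ × J) × ℤ) ℂ L2R, ∀ q, b q = dilBasis K q.1.1 q.1.2 q.2 := by
  -- The basis groups sign with `j`, but the pieces of the partition are indexed by sign and scale.
  let σ : (ℤˣ × J) × ℤ ≃ (ℤˣ × ℤ) × J :=
    { toFun := fun q => ((q.1.1, q.2), q.1.2)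
      invFun := fun q => ((q.1.1, q.2), q.1.2)
      left_inv := fun q => rfl
      right_inv := fun q => rfl }
  have hshell : ∀ s, MeasurableSet (dyadicShell s) := fun s =>
    measurableSet_Ico.preimage (measurable_const_mul (((s : ℤ) : ℝ)))
  have hpos : ∀ n : ℤ, (0 : ℝ) < 2 ^ n := fun n => by positivity
  refine exists_hilbertBasis_of_partition σ
    (fun a => (fun x : ℝ => 2 ^ a.2 * x) ⁻¹' dyadicShell a.1)
    (fun a => (hshell _).preimage (measurable_const_mul _)) ?_ ?_
    (fun a j => (dilation ^ a.2) (K a.1 j)) fun a => ?_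
  -- If `m' < m`, then `2 ^ m * x ≥ 2 * (2 ^ m' * x) ≥ 2`, outside the shell.
  · have key : ∀ (x : ℝ) (m m' : ℤ), 2 ^ m * x ∈ Set.Ico (1 : ℝ) 2 →
        2 ^ m' * x ∈ Set.Ico (1 : ℝ) 2 → m ≤ m' := by
      intro x m m' h h'
      by_contra hlt
      push Not at hlt
      have hx : 0 < x := pos_of_mul_pos_right (zero_lt_one.trans_le h.1) (hpos m).le
      have h2 : (2 : ℝ) ^ (m' + 1) ≤ 2 ^ m := zpow_le_zpow_right₀ (by norm_num) (by omega)
      rw [zpow_add_one₀ (by norm_num)] at h2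
      have := mul_le_mul_of_nonneg_right h2 hx.le
      linarith [h.2, h'.1]
    rintro ⟨s, m⟩ ⟨s', m'⟩ hne
    refine Set.disjoint_left.2 fun x h1 h2 => hne ?_
    simp only [dyadicShell, Set.mem_preimage, Set.mem_ofPred_eq] at h1 h2
    have hs : s = s' := by
      have p1 := zero_lt_one.trans_le h1.1
      have p2 := zero_lt_one.trans_le h2.1
      rcases Int.units_eq_one_or s with rfl | rfl <;> rcases Int.units_eq_one_or s' with rfl | rfl
      · rfl
      · simp only [Units.val_one, Int.cast_one, one_mul, Units.val_neg, Int.cast_neg,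
          neg_mul, ← mul_neg] at p1 p2
        linarith [pos_of_mul_pos_right p1 (hpos m).le, pos_of_mul_pos_right p2 (hpos m').le]
      · simp only [Units.val_one, Int.cast_one, one_mul, Units.val_neg, Int.cast_neg,
          neg_mul, ← mul_neg] at p1 p2
        linarith [pos_of_mul_pos_right p1 (hpos m).le, pos_of_mul_pos_right p2 (hpos m').le]
      · rfl
    subst hs
    rw [mul_left_comm] at h1 h2
    exact Prod.ext rfl (le_antisymm (key _ _ _ h1 h2) (key _ _ _ h2 h1))
  · have hne : ∀ᵐ x : ℝ, x ≠ 0 := by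
      rw [ae_iff]
      simp
    filter_upwards [hne] with x hx
    obtain ⟨n, h1, h2⟩ := exists_mem_Ico_zpow (abs_pos.2 hx) (one_lt_two : (1 : ℝ) < 2)
    have h3 : (2 : ℝ) ^ (-n) * |x| ∈ Set.Ico (1 : ℝ) 2 := by
      rw [zpow_neg, inv_mul_eq_div]
      refine ⟨(one_le_div (hpos n)).2 h1, (div_lt_iff₀ (hpos n)).2 ?_⟩
      rwa [zpow_add_one₀ (by norm_num), mul_comm] at h2
    rcases lt_or_gt_of_ne hx with hlt | hgt
    · refine ⟨(-1, -n), ?_⟩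
      rw [abs_of_neg hlt] at h3
      simpa [dyadicShell] using h3
    · refine ⟨(1, -n), ?_⟩
      rw [abs_of_pos hgt] at h3
      simpa [dyadicShell] using h3
  · refine (hK a.1).zpow (U := dilation) (c := (Real.sqrt 2 : ℂ)) (φ := fun n x => 2 ^ n * x)
      (by simp) (fun n => quasi_mul (hpos n))
      (fun x => by simp) (fun m n x => by rw [zpow_add₀ (by norm_num)]; ring) (fun f => ?_) a.2
    filter_upwards [dilation_ae f] with x hx
    simp [hx]

/-! ### The monomials on the circle -/

theorem coeFn_monomial (m : ℤ) :
    ∀ᵐ ω ∂circleMeasure, monomial m ω = ((ω ^ m : Circle) : ℂ) :=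
  (memLp_monomial m).coeFn_toLp

/-- `circleMeasure` is a push-forward, so pulling back to the additive circle is an isometry that
carries monomials to the Fourier characters. Orthonormality and totality are inherited from there;
injectivity of the pull-back suffices. -/
theorem exists_hilbertBasis_monomial :
    ∃ b : HilbertBasis ℤ ℂ (L2Circle ℂ), ∀ m, b m = monomial m := by
  have hT : Fact (0 < 2 * Real.pi) := ⟨Real.two_pi_pos⟩
  have hmp : MeasurePreserving (fun θ : AddCircle (2 * Real.pi) => AddCircle.toCircle θ)
      AddCircle.haarAddCircle circleMeasure :=
    ⟨AddCircle.continuous_toCircle.measurable, rfl⟩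
  let Φ : L2Circle ℂ →ₗᵢ[ℂ] Lp ℂ 2 (AddCircle.haarAddCircle (T := 2 * Real.pi)) :=
    Lp.compMeasurePreservingₗᵢ ℂ _ hmp
  have hΦ : ∀ m, Φ (monomial m) = fourierLp 2 m := by
    intro m
    apply Lp.ext
    filter_upwards [Lp.coeFn_compMeasurePreserving (monomial m) hmp,
      hmp.quasiMeasurePreserving.ae (coeFn_monomial m), coeFn_fourierLp 2 m] with θ h1 h2 h3
    rw [h3, fourier_apply, AddCircle.toCircle_zsmul, ← h2]
    exact h1
  have ho : Orthonormal ℂ monomial := by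
    rw [← Φ.orthonormal_comp_iff]
    convert orthonormal_fourier (T := 2 * Real.pi) using 1
    exact funext hΦ
  refine ⟨HilbertBasis.mkOfOrthogonalEqBot ho ?_, fun m => by
    rw [HilbertBasis.coe_mkOfOrthogonalEqBot]⟩
  rw [Submodule.eq_bot_iff]
  intro f hf
  have h0 : ∀ m, inner ℂ (fourierBasis (T := 2 * Real.pi) m) (Φ f) = 0 := fun m => by
    rw [coe_fourierBasis, ← hΦ, Φ.inner_map_map]
    exact (Submodule.mem_orthogonal _ _).1 hf _ (Submodule.subset_span ⟨m, rfl⟩)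
  have h1 : Φ f = 0 := by
    refine (fourierBasis (T := 2 * Real.pi)).repr.map_eq_zero_iff.1 ?_
    ext m
    rw [HilbertBasis.repr_apply_apply, h0]; rfl
  exact (map_eq_zero_iff Φ Φ.injective).1 h1

/-! ### Vector-valued functions on the circle -/

section CircleVector

variable {H : Type*} [NormedAddCommGroup H] [InnerProductSpace ℂ H]

theorem coeFn_alongVec (x : H) (h : L2Circle ℂ) :
    ∀ᵐ ω ∂circleMeasure, alongVec x h ω = h ω • x :=
  ContinuousLinearMap.coeFn_compLpL _ _

theorem coeFn_componentAt (x : H) (v : L2Circle H) :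
    ∀ᵐ ω ∂circleMeasure, componentAt x v ω = inner ℂ x (v ω) :=
  ContinuousLinearMap.coeFn_compLpL _ _

/-- Adjointness of `alongVec x` and `componentAt x`: vector Fourier coefficients are scalar ones of
a component. -/
theorem inner_alongVec_left (x : H) (h : L2Circle ℂ) (v : L2Circle H) :
    inner ℂ (alongVec x h) v = inner ℂ h (componentAt x v) := by
  rw [L2.inner_def, L2.inner_def]
  refine integral_congr_ae ?_
  filter_upwards [coeFn_alongVec x h, coeFn_componentAt x v] with ω h1 h2
  rw [h1, h2, inner_smul_left, RCLike.inner_apply, mul_comm]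

theorem componentAt_alongVec (x y : H) (h : L2Circle ℂ) :
    componentAt x (alongVec y h) = inner ℂ x y • h := by
  apply Lp.ext
  filter_upwards [coeFn_componentAt x (alongVec y h), coeFn_alongVec y h,
    Lp.coeFn_smul (inner ℂ x y) h] with ω h1 h2 h3
  rw [h1, h2, h3, inner_smul_right, Pi.smul_apply, smul_eq_mul, mul_comm]

theorem eq_zero_of_componentAt_eq_zero {P : Type*} [Countable P] (u : HilbertBasis P ℂ H)
    {v : L2Circle H} (hv : ∀ p, componentAt (u p) v = 0) : v = 0 := by
  rw [Lp.eq_zero_iff_ae_eq_zero]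
  have h : ∀ p, ∀ᵐ ω ∂circleMeasure, inner ℂ (u p) (v ω) = 0 := fun p => by
    filter_upwards [coeFn_componentAt (u p) v, Lp.eq_zero_iff_ae_eq_zero.1 (hv p)] with ω h1 h2
    rw [← h1, h2, Pi.zero_apply]
  filter_upwards [ae_all_iff.2 h] with ω hω
  refine u.repr.map_eq_zero_iff.1 ?_
  ext p
  rw [HilbertBasis.repr_apply_apply, hω]; rfl

/-- The functions `ω ↦ ω^m u_p` form an orthonormal basis of `L²(∂𝔻; H)`. -/
theorem exists_hilbertBasis_alongVec_monomial [CompleteSpace H] {P : Type*} [Countable P]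
    (u : HilbertBasis P ℂ H) :
    ∃ b : HilbertBasis (P × ℤ) ℂ (L2Circle H), ∀ q, b q = alongVec (u q.1) (monomial q.2) := by
  classical
  obtain ⟨b, hb⟩ := exists_hilbertBasis_monomial
  have ho : Orthonormal ℂ fun q : P × ℤ => alongVec (u q.1) (monomial q.2) := by
    rw [orthonormal_iff_ite]
    rintro ⟨p, m⟩ ⟨p', m'⟩
    rw [inner_alongVec_left, componentAt_alongVec, inner_smul_right, ← hb, ← hb,
      orthonormal_iff_ite.1 u.orthonormal, orthonormal_iff_ite.1 b.orthonormal]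
    by_cases h1 : p = p' <;> by_cases h2 : m = m' <;> simp [h1, h2]
  refine ⟨HilbertBasis.mkOfOrthogonalEqBot ho ?_, fun m => by
    rw [HilbertBasis.coe_mkOfOrthogonalEqBot]⟩
  rw [Submodule.eq_bot_iff]
  intro v hv
  refine eq_zero_of_componentAt_eq_zero u fun p => b.repr.map_eq_zero_iff.1 ?_
  ext m
  rw [HilbertBasis.repr_apply_apply, hb, ← inner_alongVec_left]
  exact (Submodule.mem_orthogonal _ _).1 hv _ (Submodule.subset_span ⟨(p, m), rfl⟩)

/-- The vectors `v` with `[M v](ω) = S(ω) v(ω)` a.e. form a closed subspace. -/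
theorem isClosed_fiber {E F : Type*} [NormedAddCommGroup E] [NormedSpace ℂ E]
    [NormedAddCommGroup F] [NormedSpace ℂ F] (M : L2Circle E →L[ℂ] L2Circle F)
    (S : Circle → E →L[ℂ] F) :
    IsClosed {v : L2Circle E | ∀ᵐ ω ∂circleMeasure, M v ω = S ω (v ω)} := by
  refine isClosed_of_closure_subset fun v hv => ?_
  obtain ⟨w, hw, hlim⟩ := mem_closure_iff_seq_limit.1 hv
  -- `L²` convergence yields a.e. convergence only along subsequences, extracted first for the
  -- arguments and then, within it, for the images.
  obtain ⟨n, hn, h1⟩ := (tendstoInMeasure_of_tendsto_Lp hlim).exists_seq_tendsto_ae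
  have hlim2 : Tendsto (fun k => M (w (n k))) atTop (𝓝 (M v)) :=
    (M.continuous.tendsto v).comp (hlim.comp hn.tendsto_atTop)
  obtain ⟨n', hn', h2⟩ := (tendstoInMeasure_of_tendsto_Lp hlim2).exists_seq_tendsto_ae
  filter_upwards [h1, h2, ae_all_iff.2 hw] with ω e1 e2 e3
  have e4 : Tendsto (fun k => M (w (n (n' k))) ω) atTop (𝓝 (S ω (v ω))) := by
    simp only [e3]
    exact ((S ω).continuous.tendsto _).comp (e1.comp hn'.tendsto_atTop)
  exact tendsto_nhds_unique e2 e4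

theorem fiber_of_dense_span {E F : Type*} [NormedAddCommGroup E] [NormedSpace ℂ E]
    [NormedAddCommGroup F] [NormedSpace ℂ F] (M : L2Circle E →L[ℂ] L2Circle F)
    (S : Circle → E →L[ℂ] F) {Q : Type*} (b : Q → L2Circle E)
    (hb : (Submodule.span ℂ (Set.range b)).topologicalClosure = ⊤)
    (h : ∀ q, ∀ᵐ ω ∂circleMeasure, M (b q) ω = S ω (b q ω)) (v : L2Circle E) :
    ∀ᵐ ω ∂circleMeasure, M v ω = S ω (v ω) := by
  have hv : v ∈ closure (Submodule.span ℂ (Set.range b) : Set (L2Circle E)) := by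
    rw [← Submodule.topologicalClosure_coe, hb]; trivial
  refine closure_minimal (fun w hw => ?_) (isClosed_fiber M S) hv
  change ∀ᵐ ω ∂circleMeasure, M w ω = S ω (w ω)
  induction hw using Submodule.span_induction with
  | mem w hw => obtain ⟨q, rfl⟩ := hw; exact h q
  | zero =>
    rw [map_zero]
    filter_upwards [Lp.coeFn_zero F 2 circleMeasure, Lp.coeFn_zero E 2 circleMeasure] with ω h1 h2
    rw [h1, h2, Pi.zero_apply, Pi.zero_apply, map_zero]
  | add v w _ _ hv hw =>
    rw [map_add]
    filter_upwards [Lp.coeFn_add (M v) (M w), Lp.coeFn_add v w, hv, hw] with ω h1 h2 h3 h4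
    rw [h1, h2, Pi.add_apply, Pi.add_apply, map_add, h3, h4]
  | smul c v _ hv =>
    rw [map_smul]
    filter_upwards [Lp.coeFn_smul c (M v), Lp.coeFn_smul c v, hv] with ω h1 h2 h3
    rw [h1, h2, Pi.smul_apply, Pi.smul_apply, map_smul, h3]

theorem memLp_zpow_smul (m : ℤ) (v : L2Circle H) :
    MemLp (fun ω => ((ω ^ m : Circle) : ℂ) • v ω) 2 circleMeasure := by
  refine (Lp.memLp v).of_le ?_ (Eventually.of_forall fun ω => ?_)
  · exact (memLp_monomial m).1.smul (Lp.aestronglyMeasurable v)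
  · rw [norm_smul, Circle.norm_coe, one_mul]

/-- If the Fourier coefficients of `w` are those of `v` shifted by `m`, then `w(ω) = ω^m v(ω)`. -/
theorem coeFn_eq_zpow_smul [CompleteSpace H] {P : Type*} [Countable P] (u : HilbertBasis P ℂ H)
    (m : ℤ) {v w : L2Circle H}
    (h : ∀ p k, inner ℂ (alongVec (u p) (monomial k)) w
      = inner ℂ (alongVec (u p) (monomial (k - m))) v) :
    ∀ᵐ ω ∂circleMeasure, w ω = ((ω ^ m : Circle) : ℂ) • v ω := by
  obtain ⟨b, hb⟩ := exists_hilbertBasis_alongVec_monomial u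
  have hw : w = (memLp_zpow_smul m v).toLp _ := by
    refine b.repr.injective (lp.ext (funext fun q => ?_))
    rw [HilbertBasis.repr_apply_apply, HilbertBasis.repr_apply_apply, hb, h, L2.inner_def,
      L2.inner_def]
    refine integral_congr_ae ?_
    filter_upwards [coeFn_alongVec (u q.1) (monomial (q.2 - m)),
      coeFn_alongVec (u q.1) (monomial q.2), coeFn_monomial q.2, coeFn_monomial (q.2 - m),
      (memLp_zpow_smul m v).coeFn_toLp] with ω h1 h2 h3 h4 h5
    rw [h1, h2, h3, h4, h5, inner_smul_left, inner_smul_left, inner_smul_right, ← mul_assoc]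
    congr 1
    -- On the circle conjugation is inversion, so both scalars equal `ω ^ (m - q.2)`.
    rw [← Circle.coe_inv_eq_conj, ← Circle.coe_inv_eq_conj, ← Circle.coe_mul]
    congr 1
    rw [← zpow_neg, ← zpow_neg, ← zpow_add]
    congr 1
    ring
  rw [hw]
  exact (memLp_zpow_smul m v).coeFn_toLp

end CircleVector

/-! ### The Fourier coefficients -/

theorem hasSum_mul_prod {A B : Type*} {f : A → ℂ} {g : B → ℂ} {x y : ℂ} (hf : HasSum f x)
    (hg : HasSum g y) : HasSum (fun q : A × B => f q.1 * g q.2) (x * y) :=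
  HasSum.mul hf hg (summable_mul_of_summable_norm hf.summable.norm hg.summable.norm)

section Coefficients

variable {I J γ : Type*} {L : I → L2R} {K : ℤˣ → J → L2R} {ψ : γ → L2R}

/-- `⟨T^j ψ_g, K_p^{(k)}⟩` at `t = (k, j, g)`, with the exponent `k` shifted by `σ`. -/
def crossCoeff (K : ℤˣ → J → L2R) (ψ : γ → L2R) (p : ℤˣ × J) (σ : ℤ) (t : ℤ × ℤ × γ) : ℂ :=
  inner ℂ (dilBasis K p.1 p.2 (t.1 + σ)) ((translation ^ t.2.1) (ψ t.2.2))

theorem inner_waveletSystem_dilBasis (p : ℤˣ × J) (m : ℤ) (t : ℤ × ℤ × γ) :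
    inner ℂ (waveletSystem ψ t) (dilBasis K p.1 p.2 m)
      = starRingEnd ℂ (crossCoeff K ψ p 0 (m - t.1, t.2)) := by
  have h : dilBasis K p.1 p.2 m = (dilation ^ t.1) (dilBasis K p.1 p.2 (m - t.1)) := by
    rw [dilBasis, dilBasis, ← Function.comp_apply (f := ⇑(dilation ^ t.1)),
      ← LinearIsometryEquiv.coe_mul, ← zpow_add, add_sub_cancel]
  rw [crossCoeff, inner_conj_symm, h, waveletSystem, LinearIsometryEquiv.inner_map_map, add_zero]

/-- The inner product is that of two analysis sequences in `ℓ²`. After `k ↦ m - k` the terms involve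
`m` and `m'` only through `m' - m`, which is the dilation invariance of `S`. -/
theorem hasSum_crossCoeff {TX : lp (fun _ : ℤ × ℤ × γ => ℂ) 2 →L[ℂ] L2R}
    (hTX : ∀ f t, ContinuousLinearMap.adjoint TX f t = inner ℂ (waveletSystem ψ t) f)
    (p p' : ℤˣ × J) (m m' : ℤ) :
    HasSum (fun t => starRingEnd ℂ (crossCoeff K ψ p 0 t) * crossCoeff K ψ p' (m' - m) t)
      (inner ℂ (dilBasis K p'.1 p'.2 m')
        (TX (ContinuousLinearMap.adjoint TX (dilBasis K p.1 p.2 m)))) := by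
  rw [← ContinuousLinearMap.adjoint_inner_left]
  let e : ℤ × ℤ × γ ≃ ℤ × ℤ × γ := (Equiv.subLeft m).prodCongr (Equiv.refl _)
  have h := lp.hasSum_inner (𝕜 := ℂ) (G := fun _ : ℤ × ℤ × γ => ℂ)
    (ContinuousLinearMap.adjoint TX (dilBasis K p'.1 p'.2 m'))
    (ContinuousLinearMap.adjoint TX (dilBasis K p.1 p.2 m))
  rw [← e.hasSum_iff] at h
  refine h.congr_fun fun t => ?_
  have he : e t = (m - t.1, t.2) := rfl
  rw [Function.comp_apply, he]
  simp only [hTX, inner_waveletSystem_dilBasis, RCLike.inner_apply, Complex.conj_conj,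
    sub_sub_cancel]
  simp only [crossCoeff, add_zero]
  rw [show t.1 + (m' - m) = m' - (m - t.1) by ring, mul_comm]

/-- Expand `ψ` in the basis `L_i^{(n)}`, then apply `T^j L_i^{(n)} = L_i^{(n+j)}` and pair with the
dilated basis vector. -/
theorem hasSum_hatCoeff_mul_changeCoeff {b : HilbertBasis (I × ℤ) ℂ L2R}
    (hb : ∀ a, b a = transBasis L a.1 a.2) (p : ℤˣ × J) (σ : ℤ) (t : ℤ × ℤ × γ) :
    HasSum (fun a : I × ℤ => hatCoeff L (ψ t.2.2) a.1 a.2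
      * changeCoeff L K a.1 (a.2 + t.2.1) p.1 p.2 (t.1 + σ)) (crossCoeff K ψ p σ t) := by
  have h := ((b.hasSum_repr (ψ t.2.2)).mapL
    ((translation ^ t.2.1).toContinuousLinearEquiv : L2R →L[ℂ] L2R)).mapL
    (innerSL ℂ (dilBasis K p.1 p.2 (t.1 + σ)))
  refine h.congr_fun fun a => ?_
  rw [map_smul, map_smul, HilbertBasis.repr_apply_apply, hb, smul_eq_mul, hatCoeff, changeCoeff]
  congr 1
  change inner ℂ _ _ = inner ℂ _ ((translation ^ t.2.1) (transBasis L a.1 a.2))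
  rw [transBasis, transBasis, add_comm a.2, zpow_add, LinearIsometryEquiv.coe_mul,
    Function.comp_apply]

theorem hasSum_alphaFactor_mul_psiFactor {b : HilbertBasis (I × ℤ) ℂ L2R}
    (hb : ∀ a, b a = transBasis L a.1 a.2) (p p' : ℤˣ × J) (σ : ℤ) (t : ℤ × ℤ × γ) :
    HasSum (fun q : (I × ℤ) × (I × ℤ) =>
        alphaFactor L K p p' σ q.1 q.2 t.1 t.2.1 * psiFactor L (ψ t.2.2) q.1 q.2)
      (starRingEnd ℂ (crossCoeff K ψ p 0 t) * crossCoeff K ψ p' σ t) := by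
  have h1 := hasSum_hatCoeff_mul_changeCoeff (K := K) (ψ := ψ) hb p 0 t
  have h2 := hasSum_hatCoeff_mul_changeCoeff (K := K) (ψ := ψ) hb p' σ t
  refine (hasSum_mul_prod (Complex.hasSum_conj'.2 h1) h2).congr_fun fun q => ?_
  simp only [alphaFactor, psiFactor, map_mul, add_zero]
  ring

theorem isUnconditionalCoeff_of_hasSum {b : HilbertBasis (I × ℤ) ℂ L2R}
    (hb : ∀ a, b a = transBasis L a.1 a.2) {p p' : ℤˣ × J} {σ : ℤ} {c : ℂ}
    (hc : HasSum (fun t => starRingEnd ℂ (crossCoeff K ψ p 0 t) * crossCoeff K ψ p' σ t) c) :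
    IsUnconditionalCoeff L K ψ p p' σ c := by
  classical
  have h := fun F : Finset (ℤ × ℤ × γ) => hasSum_sum (s := F) fun t _ =>
    hasSum_alphaFactor_mul_psiFactor (K := K) (ψ := ψ) hb p p' σ t
  have hlim : Tendsto (fun F : Finset (ℤ × ℤ × γ) => ∑' q : (I × ℤ) × (I × ℤ),
      ∑ t ∈ F, alphaFactor L K p p' σ q.1 q.2 t.1 t.2.1 * psiFactor L (ψ t.2.2) q.1 q.2)
      atTop (𝓝 c) := by
    simp only [(h _).tsum_eq]
    exact hc
  refine ⟨fun F => (h F).summable, hlim, ?_⟩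
  let e : Finset (ℤ × ℤ) × Finset γ → Finset (ℤ × ℤ × γ) := fun AB =>
    (AB.1 ×ˢ AB.2).map (Equiv.prodAssoc ℤ ℤ γ).toEmbedding
  -- Product sets are cofinal: `F` is contained in the product of its projections.
  have he : Tendsto e atTop atTop := by
    refine tendsto_atTop.2 fun F => eventually_atTop.2
      ⟨(F.image fun t => (t.1, t.2.1), F.image fun t => t.2.2), fun AB hAB t ht => ?_⟩
    refine Finset.mem_map.2 ⟨((t.1, t.2.1), t.2.2), Finset.mem_product.2 ⟨?_, ?_⟩, rfl⟩
    · exact hAB.1 (Finset.mem_image_of_mem (fun t : ℤ × ℤ × γ => (t.1, t.2.1)) ht)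
    · exact hAB.2 (Finset.mem_image_of_mem (fun t : ℤ × ℤ × γ => t.2.2) ht)
  convert hlim.comp he using 1
  funext AB
  refine tsum_congr fun q => ?_
  rw [Finset.sum_map, Finset.sum_product, Finset.sum_mul_sum]
  rfl

end Coefficients

/-! ### The dilation representation -/

section Representation

variable {J : Type*} [Countable J] {K : ℤˣ → J → L2R}

/-- The unitary that maps `K_p^{(m)}` to `ω ↦ ω^m u_p` is the dilation representation. -/
theorem exists_isDilationRepresentation (hK : ∀ s : ℤˣ, IsONBOn (dyadicShell s) (K s))
    (u : HilbertBasis (ℤˣ × J) ℂ (L2Sum J)) :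
    ∃ G : L2R ≃ₗᵢ[ℂ] L2Circle (L2Sum J), IsDilationRepresentation K u G ∧
      ∀ p m, G (dilBasis K p.1 p.2 m) = alongVec (u p) (monomial m) := by
  classical
  obtain ⟨b, hb⟩ := exists_hilbertBasis_dilBasis hK
  obtain ⟨e, he⟩ := exists_hilbertBasis_alongVec_monomial u
  obtain ⟨z, hz⟩ := exists_hilbertBasis_monomial
  let G : L2R ≃ₗᵢ[ℂ] L2Circle (L2Sum J) := b.repr.trans e.repr.symm
  have hG : ∀ p m, G (dilBasis K p.1 p.2 m) = alongVec (u p) (monomial m) := fun p m => by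
    rw [← he (p, m), ← hb (p, m), LinearIsometryEquiv.trans_apply, b.repr_self, ← e.repr_self,
      LinearIsometryEquiv.symm_apply_apply]
  refine ⟨G, fun f => ?_, hG⟩
  have hcomp : ∀ p, HasSum (fun m : ℤ => tildeCoeff K f p.1 p.2 m • monomial m)
      (componentAt (u p) (G f)) := fun p => by
    convert z.hasSum_repr (componentAt (u p) (G f)) using 2 with m
    rw [HilbertBasis.repr_apply_apply, hz, ← inner_alongVec_left, ← hG,
      LinearIsometryEquiv.inner_map_map, tildeCoeff]
  refine ⟨fun p => componentAt (u p) (G f), hcomp, ?_⟩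
  have hsum : HasSum (fun q : (ℤˣ × J) × ℤ =>
      alongVec (u q.1) (tildeCoeff K f q.1.1 q.1.2 q.2 • monomial q.2)) (G f) := by
    refine ((b.hasSum_repr f).mapL
      (G.toContinuousLinearEquiv : L2R →L[ℂ] L2Circle (L2Sum J))).congr_fun fun q => ?_
    rw [map_smul, map_smul, HilbertBasis.repr_apply_apply, hb, ← hG]
    rfl
  -- The joint expansion over `(p, m)` is regrouped: first over `m`, then over `p`.
  exact hsum.prod_fiberwise fun p => (hcomp p).mapL (alongVec (u p))

end Representation

/-! ### Decomposable operators -/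

section Decomposable

variable {H : Type*} [NormedAddCommGroup H] [InnerProductSpace ℂ H]

theorem norm_sq_eq_integral (v : L2Circle H) : ‖v‖ ^ 2 = ∫ ω, ‖v ω‖ ^ 2 ∂circleMeasure := by
  have h := L2.inner_def (𝕜 := ℂ) v v
  simp only [inner_self_eq_norm_sq_to_K] at h
  have h2 : ((‖v‖ ^ 2 : ℝ) : ℂ) = ((∫ ω, ‖v ω‖ ^ 2 ∂circleMeasure : ℝ) : ℂ) := by
    rw [← integral_complex_ofReal]
    push_cast
    exact h
  exact_mod_cast h2

/-- Testing on the indicator of `s` gives `∫_s ‖w‖² ≤ ‖M‖² μ(s)` for every measurable `s`, which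
forces the pointwise bound. -/
theorem ae_norm_le_of_multiplication {M : L2Circle ℂ →L[ℂ] L2Circle H} {w : L2Circle H}
    (hM : ∀ h : L2Circle ℂ, ∀ᵐ ω ∂circleMeasure, M h ω = h ω • w ω) :
    ∀ᵐ ω ∂circleMeasure, ‖w ω‖ ≤ ‖M‖ := by
  have hint : Integrable (fun ω => ‖w ω‖ ^ 2) circleMeasure := (Lp.memLp w).integrable_norm_pow'
  have key : (fun ω => ‖w ω‖ ^ 2) ≤ᵐ[circleMeasure] fun _ => ‖M‖ ^ 2 := by
    refine ae_le_of_forall_setIntegral_le hint (integrable_const _) fun s hs hsμ => ?_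
    set h : L2Circle ℂ := indicatorConstLp 2 hs hsμ.ne 1 with hh
    have h1 : ‖M h‖ ^ 2 = ∫ ω in s, ‖w ω‖ ^ 2 ∂circleMeasure := by
      rw [norm_sq_eq_integral, ← integral_indicator hs]
      refine integral_congr_ae ?_
      filter_upwards [hM h, indicatorConstLp_coeFn (p := 2) (hs := hs) (hμs := hsμ.ne)
        (c := (1 : ℂ))] with ω e1 e2
      rw [e1, hh, e2]
      by_cases hω : ω ∈ s <;> simp [hω]
    have h2 : ‖h‖ ^ 2 = circleMeasure.real s := by
      rw [hh, norm_indicatorConstLp (by norm_num) (by norm_num), norm_one, one_mul,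
        ENNReal.toReal_ofNat, ← Real.sqrt_eq_rpow, Real.sq_sqrt measureReal_nonneg]
    rw [← h1, setIntegral_const, smul_eq_mul, ← h2, ← mul_pow, mul_comm]
    exact pow_le_pow_left₀ (norm_nonneg _) (M.le_opNorm h) 2
  filter_upwards [key] with ω hω
  exact le_of_sq_le_sq hω M.opNorm_nonneg

theorem alongVec_add (x y : H) : alongVec (x + y) = alongVec x + alongVec y := by
  refine ContinuousLinearMap.ext fun h => Lp.ext ?_
  filter_upwards [coeFn_alongVec (x + y) h, coeFn_alongVec x h, coeFn_alongVec y h,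
    Lp.coeFn_add (alongVec x h) (alongVec y h)] with ω h1 h2 h3 h4
  rw [_root_.add_apply, h1, h4, Pi.add_apply, h2, h3, smul_add]

theorem alongVec_smul (c : ℂ) (x : H) : alongVec (c • x) = c • alongVec x := by
  refine ContinuousLinearMap.ext fun h => Lp.ext ?_
  filter_upwards [coeFn_alongVec (c • x) h, coeFn_alongVec x h,
    Lp.coeFn_smul c (alongVec x h)] with ω h1 h2 h3
  rw [_root_.smul_apply, h1, h3, Pi.smul_apply, h2, smul_comm]

theorem norm_alongVec_le (x : H) : ‖alongVec x‖ ≤ ‖x‖ := by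
  refine ContinuousLinearMap.opNorm_le_bound _ (norm_nonneg _) fun h => ?_
  rw [mul_comm]
  refine le_of_sq_le_sq ?_ (by positivity)
  rw [mul_pow, norm_sq_eq_integral, norm_sq_eq_integral, ← integral_mul_const]
  refine le_of_eq (integral_congr_ae ?_)
  filter_upwards [coeFn_alongVec x h] with ω h1
  rw [h1, norm_smul, mul_pow]

variable {P : Type*} {u : P → H} {A : L2Circle H →L[ℂ] L2Circle H} {a : P → L2Circle H}

theorem apply_alongVec_ae
    (hA : ∀ p m, ∀ᵐ ω ∂circleMeasure,
      A (alongVec (u p) (monomial m)) ω = ((ω ^ m : Circle) : ℂ) • a p ω)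
    (p : P) (h : L2Circle ℂ) : ∀ᵐ ω ∂circleMeasure, A (alongVec (u p) h) ω = h ω • a p ω := by
  obtain ⟨b, hb⟩ := exists_hilbertBasis_monomial
  refine fiber_of_dense_span (A.comp (alongVec (u p)))
    (fun ω => ContinuousLinearMap.toSpanSingleton ℂ (a p ω)) b b.dense_span (fun m => ?_) h
  rw [hb]
  filter_upwards [hA p m, coeFn_monomial m] with ω h1 h2
  rw [ContinuousLinearMap.toSpanSingleton_apply, h2, ← h1]
  rfl

theorem apply_alongVec_sum_ae
    (hA : ∀ p (h : L2Circle ℂ), ∀ᵐ ω ∂circleMeasure, A (alongVec (u p) h) ω = h ω • a p ω)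
    (c : P → ℂ) (F : Finset P) (h : L2Circle ℂ) :
    ∀ᵐ ω ∂circleMeasure, A (alongVec (∑ p ∈ F, c p • u p) h) ω = h ω • ∑ p ∈ F, c p • a p ω := by
  classical
  induction F using Finset.induction_on with
  | empty =>
    filter_upwards [Lp.coeFn_zero H 2 circleMeasure] with ω h0
    have h1 : alongVec (0 : H) h = 0 := by
      have := congrArg (fun T : L2Circle ℂ →L[ℂ] L2Circle H => T h) (alongVec_smul (0 : ℂ) (0 : H))
      simpa using this
    rw [Finset.sum_empty, Finset.sum_empty, h1, map_zero, h0, smul_zero, Pi.zero_apply]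
  | insert p F hp ih =>
    rw [Finset.sum_insert hp, alongVec_add, alongVec_smul, _root_.add_apply,
      _root_.smul_apply, map_add, map_smul]
    filter_upwards [ih, hA p h, Lp.coeFn_add (c p • A (alongVec (u p) h))
      (A (alongVec (∑ p ∈ F, c p • u p) h)), Lp.coeFn_smul (c p) (A (alongVec (u p) h))]
      with ω h1 h2 h3 h4
    rw [h3, Pi.add_apply, h4, Pi.smul_apply, h1, h2, Finset.sum_insert hp, smul_add, smul_comm]

/-- With `x = ∑ c_p u_p`, the map `h ↦ A (h x)` is multiplication by `∑ c_p a_p` and has norm at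
most `‖A‖ ‖x‖`. The exceptional null set still depends on `c` and `F`. -/
theorem ae_norm_sum_le
    (hA : ∀ p (h : L2Circle ℂ), ∀ᵐ ω ∂circleMeasure, A (alongVec (u p) h) ω = h ω • a p ω)
    (c : P → ℂ) (F : Finset P) :
    ∀ᵐ ω ∂circleMeasure, ‖∑ p ∈ F, c p • a p ω‖ ≤ ‖A‖ * ‖∑ p ∈ F, c p • u p‖ := by
  have h1 := apply_alongVec_sum_ae hA c F (monomial 0)
  -- Since `monomial 0` is the constant `1`, its image under `M` is an `L²` representative of the
  -- multiplier.
  set M : L2Circle ℂ →L[ℂ] L2Circle H := A.comp (alongVec (∑ p ∈ F, c p • u p)) with hMdef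
  have h2 : ∀ᵐ ω ∂circleMeasure, M (monomial 0) ω = ∑ p ∈ F, c p • a p ω := by
    filter_upwards [h1, coeFn_monomial 0] with ω e1 e2
    rw [e2, zpow_zero, Circle.coe_one, one_smul] at e1
    exact e1
  have h3 : ∀ᵐ ω ∂circleMeasure, ‖M (monomial 0) ω‖ ≤ ‖M‖ := by
    refine ae_norm_le_of_multiplication fun h => ?_
    filter_upwards [apply_alongVec_sum_ae hA c F h, h2] with ω e1 e2
    rw [e2, ← e1]
    rfl
  filter_upwards [h2, h3] with ω e2 e3
  rw [← e2]
  refine e3.trans ((ContinuousLinearMap.opNorm_comp_le _ _).trans ?_)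
  exact mul_le_mul_of_nonneg_left (norm_alongVec_le _) (norm_nonneg _)

/-- An operator on `L²(∂𝔻; H)` that maps `h u_p` to `h a_p` is decomposable. -/
theorem exists_isFiberField [CompleteSpace H] [Countable P] (u : HilbertBasis P ℂ H)
    (hA : ∀ p (h : L2Circle ℂ), ∀ᵐ ω ∂circleMeasure, A (alongVec (u p) h) ω = h ω • a p ω) :
    ∃ S : Circle → H →L[ℂ] H, IsFiberField A S := by
  classical
  let e : (P →₀ ℂ) →ₗ[ℂ] H := Finsupp.linearCombination ℂ u
  let f : Circle → (P →₀ ℂ) →ₗ[ℂ] H := fun ω => Finsupp.linearCombination ℂ fun p => a p ω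
  have he : DenseRange e := by
    have h1 : Set.range e = (Submodule.span ℂ (Set.range u) : Set H) := by
      rw [← Finsupp.range_linearCombination]; rfl
    rw [DenseRange, h1, dense_iff_closure_eq, ← Submodule.topologicalClosure_coe, u.dense_span]
    rfl
  -- One null set serves all `x`: there are countably many finite sets `F`, `P → ℂ` is separable,
  -- and for fixed `F` the inequality is closed in the coefficients.
  have hbound : ∀ᵐ ω ∂circleMeasure, ∀ x, ‖f ω x‖ ≤ ‖A‖ * ‖e x‖ := by
    filter_upwards [ae_all_iff.2 fun F : Finset P => ae_all_iff.2 fun n : ℕ =>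
      ae_norm_sum_le hA (TopologicalSpace.denseSeq (P → ℂ) n) F] with ω hω x
    have hcl : IsClosed {c : P → ℂ |
        ‖∑ p ∈ x.support, c p • a p ω‖ ≤ ‖A‖ * ‖∑ p ∈ x.support, c p • u p‖} :=
      isClosed_le (by fun_prop) (by fun_prop)
    exact (TopologicalSpace.denseRange_denseSeq (P → ℂ)).induction_on
      (p := fun c => ‖∑ p ∈ x.support, c p • a p ω‖ ≤ ‖A‖ * ‖∑ p ∈ x.support, c p • u p‖)
      (x : P → ℂ) hcl fun n => hω x.support n
  -- Where the bound holds this is the continuous extension; the remaining `ω` form a null set and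
  -- do not matter.
  refine ⟨fun ω => (f ω).extendOfNorm e, fun v => ?_⟩
  obtain ⟨b, hb⟩ := exists_hilbertBasis_alongVec_monomial u
  refine fiber_of_dense_span A _ b b.dense_span (fun q => ?_) v
  rw [hb]
  filter_upwards [hbound, hA q.1 (monomial q.2), coeFn_alongVec (u q.1) (monomial q.2)]
    with ω h1 h2 h3
  have h4 : (f ω).extendOfNorm e (u q.1) = a q.1 ω := by
    have h5 := LinearMap.extendOfNorm_eq he ⟨‖A‖, h1⟩ (Finsupp.single q.1 1)
    simpa [e, f] using h5
  rw [h2, h3, map_smul, h4]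

end Decomposable

theorem hasSum_componentAt_smul_monomial {H : Type*} [NormedAddCommGroup H]
    [InnerProductSpace ℂ H] (x : H) (v : L2Circle H) :
    HasSum (fun σ : ℤ => (inner ℂ (alongVec x (monomial σ)) v : ℂ) • monomial σ)
      (componentAt x v) := by
  obtain ⟨z, hz⟩ := exists_hilbertBasis_monomial
  refine (z.hasSum_repr (componentAt x v)).congr_fun fun σ => ?_
  rw [HilbertBasis.repr_apply_apply, hz, ← inner_alongVec_left]

end WaveletSpectral

end

/-! ### The main theorem -/

open WaveletSpectral in
theorem theorem2 {I J γ : Type*} [Countable I] [Countable J] [Countable γ]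
    (L : I → L2R) (hL : IsONBOn (Set.Ico (0 : ℝ) 1) L)
    (K : ℤˣ → J → L2R) (hK : ∀ s : ℤˣ, IsONBOn (dyadicShell s) (K s))
    (u : HilbertBasis (ℤˣ × J) ℂ (L2Sum J))
    (ψ : γ → L2R) (hX : IsBessel (waveletSystem ψ)) :
    ∃ (TX : lp (fun _ : ℤ × ℤ × γ => ℂ) 2 →L[ℂ] L2R)
      (G : L2R ≃ₗᵢ[ℂ] L2Circle (L2Sum J))
      (A : L2Circle (L2Sum J) →L[ℂ] L2Circle (L2Sum J))
      (c : ℤˣ × J → ℤˣ × J → ℤ → ℂ)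
      (symb : ℤˣ × J → ℤˣ × J → L2Circle ℂ),
      -- `TX` is the synthesis operator, `G` the dilation representation, `A = G (TX TX*) G⁻¹`
      IsSynthesis (waveletSystem ψ) TX ∧
      IsDilationRepresentation K u G ∧
      (∀ v, A v = G (TX (ContinuousLinearMap.adjoint TX (G.symm v)))) ∧
      -- the Fourier coefficients, and the Fourier series they are the coefficients of
      (∀ p p' σ, IsUnconditionalCoeff L K ψ p p' σ (c p p' σ)) ∧
      (∀ p p', HasSum (fun σ : ℤ => c p p' σ • monomial σ) (symb p p')) ∧
      -- the matrix elements are multiplications by the Fourier series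
      (∀ p p' (h : L2Circle ℂ), ∀ᵐ ω ∂circleMeasure,
        matrixElement A (u p) (u p') h ω = h ω * symb p p' ω) ∧
      -- `A` is decomposable, and the fibers are given by the same Fourier series
      (∃ S : Circle → L2Sum J →L[ℂ] L2Sum J, IsFiberField A S) ∧
      (∀ S : Circle → L2Sum J →L[ℂ] L2Sum J, IsFiberField A S →
        ∀ᵐ ω ∂circleMeasure, ∀ p,
          HasSum (fun p' => symb p p' ω • u p') (S ω (u p))) := by
  obtain ⟨TX, hTX, hadj⟩ := hX.exists_isSynthesis
  obtain ⟨G, hG, hGb⟩ := exists_isDilationRepresentation hK u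
  obtain ⟨bL, hbL⟩ := exists_hilbertBasis_transBasis hL
  let A : L2Circle (L2Sum J) →L[ℂ] L2Circle (L2Sum J) :=
    (G.toContinuousLinearEquiv : L2R →L[ℂ] L2Circle (L2Sum J)).comp
      ((TX.comp (ContinuousLinearMap.adjoint TX)).comp
        (G.symm.toContinuousLinearEquiv : L2Circle (L2Sum J) →L[ℂ] L2R))
  have hA : ∀ v, A v = G (TX (ContinuousLinearMap.adjoint TX (G.symm v))) := fun v => rfl
  have hsum : ∀ p p' m m',
      HasSum (fun t => starRingEnd ℂ (crossCoeff K ψ p 0 t) * crossCoeff K ψ p' (m' - m) t)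
        (inner ℂ (alongVec (u p') (monomial m')) (A (alongVec (u p) (monomial m)))) := by
    intro p p' m m'
    have h := hasSum_crossCoeff (K := K) hadj p p' m m'
    rwa [← G.inner_map_map, hGb, ← G.symm_apply_apply (dilBasis K p.1 p.2 m), hGb] at h
  -- The columns of `A`: images of the constant functions `u p`.
  let a : ℤˣ × J → L2Circle (L2Sum J) := fun p => A (alongVec (u p) (monomial 0))
  have hshift : ∀ p m, ∀ᵐ ω ∂circleMeasure,
      A (alongVec (u p) (monomial m)) ω = ((ω ^ m : Circle) : ℂ) • a p ω := by
    refine fun p m => coeFn_eq_zpow_smul u m fun p' k => ?_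
    have h := hsum p p' 0 (k - m)
    rw [sub_zero] at h
    -- Both Fourier coefficients are sums of the same series, with shift `k - m`.
    exact (hsum p p' m k).unique h
  have hmul := apply_alongVec_ae hshift
  refine ⟨TX, G, A, fun p p' σ => inner ℂ (alongVec (u p') (monomial σ)) (a p),
    fun p p' => componentAt (u p') (a p), hTX, hG, hA, fun p p' σ => ?_,
    fun p p' => hasSum_componentAt_smul_monomial _ _, fun p p' h => ?_,
    exists_isFiberField u hmul, fun S hS => ?_⟩
  · refine isUnconditionalCoeff_of_hasSum hbL ?_
    have h := hsum p p' 0 σ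
    rwa [sub_zero] at h
  · filter_upwards [coeFn_componentAt (u p') (A (alongVec (u p) h)),
      coeFn_componentAt (u p') (a p), hmul p h] with ω h1 h2 h3
    rw [h2, ← smul_eq_mul, ← inner_smul_right_eq_smul, ← h3, ← h1]
    rfl
  -- Any fiber field, tested on the constant function `u p`, satisfies `S ω (u p) = a p ω` a.e.;
  -- countability of the indices merges the null sets.
  · rw [ae_all_iff]
    intro p
    filter_upwards [ae_all_iff.2 fun p' => coeFn_componentAt (u p') (a p),
      hS (alongVec (u p) (monomial 0)), coeFn_alongVec (u p) (monomial 0), coeFn_monomial 0]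
      with ω h1 h2 h3 h4
    rw [h3, h4, zpow_zero, Circle.coe_one, one_smul] at h2
    refine (u.hasSum_repr (S ω (u p))).congr_fun fun p' => ?_
    rw [h1, HilbertBasis.repr_apply_apply, ← h2]
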